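/- Let $\mathfrak h$ be a finite-dimensional complex Hilbert space, $I$ a countable set and $(a_i)_{i\in I}$ operators on $\mathfrak h$ with $\sum_{i\in I}a_i^*a_i=\mathbf 1$ (strong convergence). A state is a positive semidefinite operator $\rho$ on $\mathfrak h$ with $\operatorname{tr}\rho=1$. Let $\Omega=I^{\{1,2,\dots\}}$ with the $\sigma$-field generated by the cylinder sets. For a state $\rho$ let $\mathbb P_\rho$ be the unique probability measure on $\Omega$ such that, for all $n\ge 0$ and $i_1,\dots,i_n\in I$, $$\mathbb P_\rho(\omega_1=i_1,\dots,\omega_n=i_n)=\operatorname{tr}\bigl(\rho\,a_{i_1}^*\cdots a_{i_n}^*a_{i_n}\cdots a_{i_1}\bigr),$$ and let $$\rho_n(\omega)=\frac{a_{\omega_n}\cdots a_{\omega_1}\,\rho\,a_{\omega_1}^*\cdots a_{\omega_n}^*}{\operatorname{tr}\bigl(\rho\,a_{\omega_1}^*\cdots a_{\omega_n}^*a_{\omega_n}\cdots a_{\omega_1}\bigr)},$$ which is defined $\mathbb P_\rho$-almost surely. Put $g(\sigma)=\operatorname{tr}(\sigma(\mathbf 1-\sigma))$. We say that (Pur) holds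 if for every state $\rho$ one has $\lim_{n\to\infty}g(\rho_n)=0$ $\mathbb P_\rho$-almost surely. Then the following are equivalent: 1. (Pur) does not hold; 2. there is an orthogonal projection $p$ on $\mathfrak h$ of rank at least $2$ such that for all $n\ge1$ and $i_1,\dots,i_n\in I$ there is a constant $\lambda_{i_1,\dots,i_n}\ge0$ with $$p\,a_{i_n}^*\cdots a_{i_1}^*a_{i_1}\cdots a_{i_n}\,p=\lambda_{i_1,\dots,i_n}\,p.$$ -/

import Mathlib

noncomputable section

open MeasureTheory Filter Topology
open scoped ComplexOrder

namespace QuantumTrajectory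

/-! ### Measures on sequences from consistent cylinder weights -/

section Cylinders

variable {I : Type*}

/-- The cylinder `Λ_{i_1,…,i_n}` of outcome sequences that start with the word `w = (i_1,…,i_n)`. -/
def cyl {n : ℕ} (w : Fin n → I) : Set (ℕ → I) := {ω | ∀ k : Fin n, ω k = w k}

variable [MeasurableSpace I] [DiscreteMeasurableSpace I] [Countable I]

theorem measurableSet_cyl {n : ℕ} (w : Fin n → I) : MeasurableSet (cyl w) := by
  have : cyl w = ⋂ k : Fin n, (fun ω : ℕ → I => ω k) ⁻¹' {w k} := by
    ext ω; simp [cyl]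
  rw [this]
  exact MeasurableSet.iInter fun k => measurable_pi_apply _ (measurableSet_singleton _)

/-- A word of length `n + 1`, indexed by `{0,…,n}`. -/
def ofIic {n : ℕ} (x : Finset.Iic n → I) : Fin (n + 1) → I :=
  fun k => x ⟨k, Finset.mem_Iic.2 (Nat.lt_succ_iff.1 k.2)⟩

/-- Existence of the measure with prescribed consistent cylinder weights. -/
theorem exists_measure_cyl (q : (n : ℕ) → (Fin n → I) → ENNReal)
    (h0 : ∀ w, q 0 w = 1)
    (hq : ∀ n (w : Fin n → I), ∑' i, q (n + 1) (Fin.snoc w i) = q n w) :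
    ∃ P : Measure (ℕ → I), IsProbabilityMeasure P ∧ ∀ n (w : Fin n → I), P (cyl w) = q n w := by
  classical
  have hle : ∀ n (w : Fin n → I), q n w ≤ 1 := by
    intro n
    induction n with
    | zero => intro w; rw [h0]
    | succ n ih =>
      intro w
      have h1 := ENNReal.le_tsum (f := fun i => q (n + 1) (Fin.snoc (Fin.init w) i))
        (w (Fin.last n))
      rw [hq] at h1
      rw [Fin.snoc_init_self] at h1
      exact h1.trans (ih _)
  let μ₀ : Measure I := Measure.sum fun i => q 1 (Fin.snoc (Fin.elim0 : Fin 0 → I) i) • Measure.dirac i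
  have hμ₀ : IsProbabilityMeasure μ₀ := ⟨by
    simp [μ₀, hq, h0]⟩
  have hμ₀' : ∀ i, μ₀ {i} = q 1 (Fin.snoc (Fin.elim0 : Fin 0 → I) i) := by
    intro i
    simp only [μ₀, Measure.sum_apply _ (measurableSet_singleton i), Measure.smul_apply,
      Measure.dirac_apply, smul_eq_mul]
    rw [tsum_eq_single i]
    · simp
    · intro j hj; simp [hj]
  let κf : (n : ℕ) → (Finset.Iic n → I) → Measure I := fun n x =>
    if q (n + 1) (ofIic x) = 0 then Measure.dirac (x ⟨0, by simp⟩)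
    else Measure.sum fun i =>
      (q (n + 2) (Fin.snoc (ofIic x) i) / q (n + 1) (ofIic x)) • Measure.dirac i
  let κ : (n : ℕ) → ProbabilityTheory.Kernel (Finset.Iic n → I) I := fun n =>
    ProbabilityTheory.Kernel.ofFunOfCountable (κf n)
  have hκ : ∀ n, ProbabilityTheory.IsMarkovKernel (κ n) := by
    intro n
    refine ⟨fun x => ?_⟩
    change IsProbabilityMeasure (κf n x)
    simp only [κf]
    split_ifs with h
    · infer_instance
    · refine ⟨?_⟩
      simp only [Measure.sum_apply _ MeasurableSet.univ, Measure.smul_apply, measure_univ,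
        smul_eq_mul, mul_one, div_eq_mul_inv]
      rw [ENNReal.tsum_mul_right, hq]
      exact ENNReal.mul_inv_cancel h ((hle _ _).trans_lt ENNReal.one_lt_top).ne
  have hκ' : ∀ n (x : Finset.Iic n → I) i,
      q (n + 1) (ofIic x) * κ n x {i} = q (n + 2) (Fin.snoc (ofIic x) i) := by
    intro n x i
    change _ * κf n x {i} = _
    by_cases h : q (n + 1) (ofIic x) = 0
    · have h1 := ENNReal.le_tsum (f := fun i => q (n + 2) (Fin.snoc (ofIic x) i)) i
      rw [hq, h] at h1
      rw [h, zero_mul, le_antisymm h1 bot_le]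
    · simp only [κf, if_neg h, Measure.sum_apply _ (measurableSet_singleton i),
        Measure.smul_apply, Measure.dirac_apply, smul_eq_mul]
      rw [tsum_eq_single i]
      · simp [ENNReal.mul_div_cancel h ((hle _ _).trans_lt ENNReal.one_lt_top).ne]
      · intro j hj; simp [hj]
  refine ⟨ProbabilityTheory.Kernel.trajMeasure (X := fun _ => I) μ₀ κ, inferInstance, ?_⟩
  set P := ProbabilityTheory.Kernel.trajMeasure (X := fun _ => I) μ₀ κ with hP
  have key : ∀ n (x : Finset.Iic n → I),
      P.map (Preorder.frestrictLe (π := fun _ => I) n) {x} = q (n + 1) (ofIic x) := by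
    intro n
    induction n with
    | zero =>
      intro x
      have hm : P.map (Preorder.frestrictLe (π := fun _ => I) 0)
          = μ₀.map (MeasurableEquiv.piUnique (fun _ : Finset.Iic 0 => I)).symm := by
        rw [hP, ProbabilityTheory.Kernel.trajMeasure, Measure.map_comp _ _ (by fun_prop),
          ProbabilityTheory.Kernel.traj_map_frestrictLe,
          ProbabilityTheory.Kernel.partialTraj_self, Measure.id_comp]
      rw [hm, MeasurableEquiv.map_apply]
      have : (MeasurableEquiv.piUnique (fun _ : Finset.Iic 0 => I)).symm ⁻¹' {x}
          = {x ⟨0, by simp⟩} := by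
        ext i
        simp only [Set.mem_preimage, Set.mem_singleton_iff, MeasurableEquiv.symm_apply_eq]
        rfl
      rw [this, hμ₀']
      congr 1
      ext k
      fin_cases k
      rfl
    | succ n ih =>
      intro x
      let x' : Finset.Iic n → I := Preorder.frestrictLe₂ (π := fun _ => I) (Nat.le_succ n) x
      let i : I := x ⟨n + 1, by simp⟩
      have e1 : P.map (Preorder.frestrictLe (π := fun _ => I) (n + 1)) {x}
          = P.map (fun ω => (Preorder.frestrictLe (π := fun _ => I) n ω, ω (n + 1)))
            ({x'} ×ˢ {i}) := by
        rw [Measure.map_apply (by fun_prop) (measurableSet_singleton _),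
          Measure.map_apply (by fun_prop)
            ((measurableSet_singleton _).prod (measurableSet_singleton _))]
        congr 1
        ext ω
        simp only [Set.mem_preimage, Set.mem_singleton_iff, Set.mem_prod]
        constructor
        · rintro rfl
          exact ⟨rfl, rfl⟩
        · rintro ⟨h1, h2⟩
          ext ⟨k, hk⟩
          rcases Nat.lt_or_ge n k with hlt | hge
          · have : k = n + 1 := le_antisymm (Finset.mem_Iic.1 hk) hlt
            subst this
            exact h2
          · exact congrFun h1 ⟨k, Finset.mem_Iic.2 hge⟩
      rw [e1, hP, ← ProbabilityTheory.Kernel.map_frestrictLe_trajMeasure_compProd_eq_map_trajMeasure,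
        Measure.compProd_apply_prod (measurableSet_singleton _) (measurableSet_singleton _),
        lintegral_singleton, ← hP, ih, mul_comm, hκ']
      congr 1
      ext k
      refine Fin.lastCases ?_ (fun k => ?_) k
      · simp [i, ofIic]
      · simp [x', ofIic]
  intro n w
  cases n with
  | zero =>
    have : cyl w = Set.univ := by ext ω; simp [cyl]
    rw [this, h0, measure_univ]
  | succ n =>
    let x : Finset.Iic n → I := fun k => w ⟨k, Nat.lt_succ_iff.2 (Finset.mem_Iic.1 k.2)⟩
    have hx : ofIic x = w := rfl
    have hc : cyl w = Preorder.frestrictLe (π := fun _ => I) n ⁻¹' {x} := by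
      ext ω
      simp only [cyl, Set.mem_ofPred_eq, Set.mem_preimage, Set.mem_singleton_iff, funext_iff,
        Subtype.forall]
      exact ⟨fun h k hk => h ⟨k, Nat.lt_succ_iff.2 (Finset.mem_Iic.1 hk)⟩,
        fun h k => h k (Finset.mem_Iic.2 (Nat.lt_succ_iff.1 k.2))⟩
    rw [hc, ← Measure.map_apply (by fun_prop) (measurableSet_singleton _), key, hx]

end Cylinders

/-! ### Repeated perfect measurements -/

variable {I H : Type*} [NormedAddCommGroup H] [InnerProductSpace ℂ H] [FiniteDimensional ℂ H]

/-- The normalization `∑ a_i^* a_i = 1`, with convergence in the strong operator topology. -/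
def IsKraus (a : I → Module.End ℂ H) : Prop :=
  ∀ x : H, HasSum (fun i => LinearMap.adjoint (a i) (a i x)) x

/-- Density matrices: positive semidefinite operators of unit trace. -/
def IsState (ρ : Module.End ℂ H) : Prop :=
  LinearMap.IsPositive ρ ∧ LinearMap.trace ℂ H ρ = 1

/-- `a_{i_1} ⋯ a_{i_n}` for the word `w = (i_1,…,i_n)`. -/
def prodLR (a : I → Module.End ℂ H) {n : ℕ} (w : Fin n → I) : Module.End ℂ H :=
  (List.ofFn fun k => a (w k)).prod

/-- `a_{i_n} ⋯ a_{i_1}` for the word `w = (i_1,…,i_n)`. -/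
def prodRL (a : I → Module.End ℂ H) {n : ℕ} (w : Fin n → I) : Module.End ℂ H :=
  (List.ofFn fun k => a (w k)).reverse.prod

/-- `tr(ρ a_{i_1}^* ⋯ a_{i_n}^* a_{i_n} ⋯ a_{i_1})`. -/
def outcomeWeight (a : I → Module.End ℂ H) (ρ : Module.End ℂ H) {n : ℕ} (w : Fin n → I) : ℂ :=
  LinearMap.trace ℂ H (ρ * LinearMap.adjoint (prodRL a w) * prodRL a w)

theorem prodRL_snoc (a : I → Module.End ℂ H) {n : ℕ} (w : Fin n → I) (i : I) :
    prodRL a (Fin.snoc w i : Fin (n + 1) → I) = a i * prodRL a w := by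
  simp only [prodRL]
  rw [List.ofFn_succ']
  simp

theorem adjoint_mul' (S T : Module.End ℂ H) :
    LinearMap.adjoint (S * T) = LinearMap.adjoint T * LinearMap.adjoint S :=
  LinearMap.adjoint_comp S T

theorem outcomeWeight_eq (a : I → Module.End ℂ H) (ρ : Module.End ℂ H) {n : ℕ} (w : Fin n → I) :
    outcomeWeight a ρ w
      = LinearMap.trace ℂ H (prodRL a w * ρ * LinearMap.adjoint (prodRL a w)) := by
  rw [outcomeWeight, LinearMap.trace_mul_comm, mul_assoc]

theorem outcomeWeight_nonneg (a : I → Module.End ℂ H) {ρ : Module.End ℂ H} (hρ : IsState ρ)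
    {n : ℕ} (w : Fin n → I) : 0 ≤ outcomeWeight a ρ w := by
  rw [outcomeWeight_eq, mul_assoc]
  exact (hρ.1.conj_adjoint (prodRL a w)).trace_nonneg

theorem hasSum_outcomeWeight {a : I → Module.End ℂ H} (ha : IsKraus a) (ρ : Module.End ℂ H)
    {n : ℕ} (w : Fin n → I) :
    HasSum (fun i => outcomeWeight a ρ (Fin.snoc w i : Fin (n + 1) → I)) (outcomeWeight a ρ w) := by
  let M := prodRL a w * ρ * LinearMap.adjoint (prodRL a w)
  have e : ∀ i, outcomeWeight a ρ (Fin.snoc w i : Fin (n + 1) → I)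
      = LinearMap.trace ℂ H (LinearMap.adjoint (a i) * a i * M) := by
    intro i
    rw [outcomeWeight_eq, prodRL_snoc, adjoint_mul', mul_assoc (LinearMap.adjoint (a i)),
      LinearMap.trace_mul_comm ℂ (LinearMap.adjoint (a i))]
    simp only [M, mul_assoc]
  simp only [e]
  rw [outcomeWeight_eq]
  change HasSum _ (LinearMap.trace ℂ H M)
  let b := stdOrthonormalBasis ℂ H
  simp only [LinearMap.trace_eq_sum_inner _ b]
  refine hasSum_sum fun j _ => ?_
  exact (ha (M (b j))).mapL (innerSL ℂ (b j))

section Law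

variable [MeasurableSpace I] [DiscreteMeasurableSpace I] [Countable I]

/-- `P` is a probability measure on outcome sequences and
`P(Λ_{i_1,…,i_n}) = tr(ρ a_{i_1}^* ⋯ a_{i_n}^* a_{i_n} ⋯ a_{i_1})`. -/
def IsOutcomeLaw (a : I → Module.End ℂ H) (ρ : Module.End ℂ H) (P : Measure (ℕ → I)) : Prop :=
  IsProbabilityMeasure P ∧
    ∀ (n : ℕ) (w : Fin n → I), P (cyl w) = ENNReal.ofReal (outcomeWeight a ρ w).re

theorem exists_isOutcomeLaw {a : I → Module.End ℂ H} (ha : IsKraus a) {ρ : Module.End ℂ H}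
    (hρ : IsState ρ) : ∃ P : Measure (ℕ → I), IsOutcomeLaw a ρ P := by
  refine exists_measure_cyl (fun n w => ENNReal.ofReal (outcomeWeight a ρ w).re) ?_ ?_
  · intro w
    simp [outcomeWeight, prodRL, hρ.2]
  · intro n w
    have h := Complex.hasSum_re (hasSum_outcomeWeight ha ρ w)
    rw [← ENNReal.ofReal_tsum_of_nonneg
      (fun i => (Complex.nonneg_iff.1 (outcomeWeight_nonneg a hρ _)).1) h.summable, h.tsum_eq]

theorem IsOutcomeLaw.unique {a : I → Module.End ℂ H} {ρ : Module.End ℂ H}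
    {P Q : Measure (ℕ → I)} (hP : IsOutcomeLaw a ρ P) (hQ : IsOutcomeLaw a ρ Q) : P = Q := by
  have := hP.1
  have := hQ.1
  refine IsProjectiveLimit.unique (P := fun J => P.map J.restrict) (fun _ => rfl) ?_
  have key : ∀ n : ℕ, Q.map (Preorder.frestrictLe (π := fun _ => I) n)
      = P.map (Preorder.frestrictLe (π := fun _ => I) n) := by
    intro n
    refine Measure.ext_of_singleton fun x => ?_
    have hc : Preorder.frestrictLe (π := fun _ => I) n ⁻¹' {x} = cyl (ofIic x) := by
      ext ω
      simp only [cyl, Set.mem_ofPred_eq, Set.mem_preimage, Set.mem_singleton_iff, funext_iff,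
        Subtype.forall]
      exact ⟨fun h k => h k (Finset.mem_Iic.2 (Nat.lt_succ_iff.1 k.2)),
        fun h k hk => h ⟨k, Nat.lt_succ_iff.2 (Finset.mem_Iic.1 hk)⟩⟩
    rw [Measure.map_apply (by fun_prop) (measurableSet_singleton _),
      Measure.map_apply (by fun_prop) (measurableSet_singleton _), hc, hP.2, hQ.2]
  intro J
  have hJ : J ⊆ Finset.Iic (J.sup id) := fun k hk => Finset.mem_Iic.2 (Finset.le_sup (f := id) hk)
  have h := congrArg (Measure.map (Finset.restrict₂ (π := fun _ => I) hJ)) (key (J.sup id))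
  rw [Measure.map_map (by fun_prop) (by fun_prop), Measure.map_map (by fun_prop) (by fun_prop)] at h
  exact h

/-- The law `ℙ_ρ` of the outcome sequence, for the initial state `ρ`. -/
def outcomeLaw {a : I → Module.End ℂ H} (ha : IsKraus a) {ρ : Module.End ℂ H}
    (hρ : IsState ρ) : Measure (ℕ → I) :=
  (exists_isOutcomeLaw ha hρ).choose

theorem isOutcomeLaw_outcomeLaw {a : I → Module.End ℂ H} (ha : IsKraus a) {ρ : Module.End ℂ H}
    (hρ : IsState ρ) : IsOutcomeLaw a ρ (outcomeLaw ha hρ) :=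
  (exists_isOutcomeLaw ha hρ).choose_spec

end Law

/-- The quantum trajectory `ρ_n(ω)`, the state conditional on the first `n` outcomes of `ω`. (The
value is `0` where the denominator vanishes, which is a null event.) -/
def trajectory (a : I → Module.End ℂ H) (ρ : Module.End ℂ H) (n : ℕ) (ω : ℕ → I) :
    Module.End ℂ H :=
  (outcomeWeight a ρ fun k : Fin n => ω k)⁻¹ •
    (prodRL a (fun k : Fin n => ω k) * ρ * LinearMap.adjoint (prodRL a fun k : Fin n => ω k))

/-- The linear entropy `g(ρ) = tr(ρ(1 - ρ))`. -/
def linearEntropy (ρ : Module.End ℂ H) : ℝ := (LinearMap.trace ℂ H (ρ * (1 - ρ))).re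

/-- (Pur): for every initial state `ρ`, `g(ρ_n) → 0` almost surely with respect to `ℙ_ρ`. -/
def Pur [MeasurableSpace I] [DiscreteMeasurableSpace I] [Countable I]
    {a : I → Module.End ℂ H} (ha : IsKraus a) : Prop :=
  ∀ (ρ : Module.End ℂ H) (hρ : IsState ρ), ∀ᵐ ω ∂(outcomeLaw ha hρ),
    Tendsto (fun n => linearEntropy (trajectory a ρ n ω)) atTop (𝓝 0)

/-- `p` is the orthogonal projection onto a dark subspace. -/
def IsDark (a : I → Module.End ℂ H) (p : Module.End ℂ H) : Prop :=
  LinearMap.IsSymmetricProjection p ∧ 2 ≤ Module.finrank ℂ (LinearMap.range p) ∧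
    ∀ (n : ℕ), 1 ≤ n → ∀ w : Fin n → I, ∃ c : ℝ, 0 ≤ c ∧
      p * LinearMap.adjoint (prodLR a w) * prodLR a w * p = (c : ℂ) • p

end QuantumTrajectory

end

/-!
Factor the initial state as `ρ = R R^*` and put `Y_n = a_{ω_n} ⋯ a_{ω_1} R`. The linear entropy of
`ρ_n` is `1 - purity Y_n`, where the purity depends only on the normalised Gram operator
`Y_n^* Y_n / ‖Y_n‖²`. The normalised Gram operators form a martingale, so by strict convexity of the
squared Hilbert–Schmidt norm the mean purity is nondecreasing, and its increment over `k` steps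
dominates the mean, for any word `A` of length `k`, of the defect measuring how far
`(A Y_n)^* (A Y_n)` is from being proportional to `Y_n^* Y_n`. Since the purity is at most `1`, the
mean defects are summable, so the defects tend to `0` almost surely.

By compactness, `Y_n / ‖Y_n‖` has cluster points `X`, and at these all defects vanish: `X^* A^* A X`
is proportional to `X^* X` for every word `A`. Either `X` has rank one, and then its purity is `1`,
or its range is a dark subspace. So without dark subspaces the purity of `Y_n` tends to `1`.
Conversely, started from `ρ = p / rank p` with `p` dark, the purity stays equal to `1 / rank p`.
-/

noncomputable section

open MeasureTheory Filter Topology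
open scoped ComplexOrder ENNReal InnerProductSpace

namespace QuantumTrajectory

section HilbertSchmidt

variable {𝕜 E F G : Type*} [RCLike 𝕜]
  [NormedAddCommGroup E] [InnerProductSpace 𝕜 E] [FiniteDimensional 𝕜 E]
  [NormedAddCommGroup F] [InnerProductSpace 𝕜 F] [FiniteDimensional 𝕜 F]
  [NormedAddCommGroup G] [InnerProductSpace 𝕜 G] [FiniteDimensional 𝕜 G]

theorem trace_adjoint_comp {ι : Type*} [Fintype ι] (b : OrthonormalBasis ι 𝕜 E) (X Y : E →ₗ[𝕜] F) :
    LinearMap.trace 𝕜 E (X.adjoint ∘ₗ Y) = ∑ i, ⟪X (b i), Y (b i)⟫_𝕜 := by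
  simp [LinearMap.trace_eq_sum_inner _ b, LinearMap.adjoint_inner_right]

/-- The Hilbert–Schmidt inner product `⟪X, Y⟫ = tr (X^* Y)` on linear maps between
finite-dimensional inner product spaces. -/
@[reducible] def hilbertSchmidtCore : InnerProductSpace.Core 𝕜 (E →ₗ[𝕜] F) where
  inner X Y := LinearMap.trace 𝕜 E (X.adjoint ∘ₗ Y)
  conj_inner_symm X Y := by
    simp only [trace_adjoint_comp (stdOrthonormalBasis 𝕜 E), map_sum, inner_conj_symm]
  re_inner_nonneg X := (RCLike.nonneg_iff.1 X.isPositive_adjoint_comp_self.trace_nonneg).1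
  add_left X Y Z := by rw [map_add, LinearMap.add_comp, map_add]
  smul_left X Y c := by rw [map_smulₛₗ, LinearMap.smul_comp, map_smul, smul_eq_mul]
  definite X hX := by
    simp only [trace_adjoint_comp (stdOrthonormalBasis 𝕜 E), inner_self_eq_norm_sq_to_K] at hX
    norm_cast at hX
    refine (stdOrthonormalBasis 𝕜 E).toBasis.ext fun i => ?_
    simpa using (Finset.sum_eq_zero_iff_of_nonneg fun _ _ => by positivity).1 hX i

/-- The Hilbert–Schmidt norm. The instance is scoped because `E →ₗ[𝕜] F` has no canonical norm. -/
@[reducible] scoped instance hilbertSchmidtNormedAddCommGroup : NormedAddCommGroup (E →ₗ[𝕜] F) :=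
  hilbertSchmidtCore.toNormedAddCommGroup

@[reducible] scoped instance hilbertSchmidtInnerProductSpace : InnerProductSpace 𝕜 (E →ₗ[𝕜] F) :=
  InnerProductSpace.ofCore hilbertSchmidtCore.toCore

theorem inner_eq_trace (X Y : E →ₗ[𝕜] F) : ⟪X, Y⟫_𝕜 = LinearMap.trace 𝕜 E (X.adjoint ∘ₗ Y) := rfl

theorem inner_eq_sum {ι : Type*} [Fintype ι] (b : OrthonormalBasis ι 𝕜 E) (X Y : E →ₗ[𝕜] F) :
    ⟪X, Y⟫_𝕜 = ∑ i, ⟪X (b i), Y (b i)⟫_𝕜 :=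
  trace_adjoint_comp b X Y

theorem trace_adjoint_comp_self (X : E →ₗ[𝕜] F) :
    LinearMap.trace 𝕜 E (X.adjoint ∘ₗ X) = (‖X‖ : 𝕜) ^ 2 :=
  inner_self_eq_norm_sq_to_K X

theorem norm_sq_eq_sum {ι : Type*} [Fintype ι] (b : OrthonormalBasis ι 𝕜 E) (X : E →ₗ[𝕜] F) :
    ‖X‖ ^ 2 = ∑ i, ‖X (b i)‖ ^ 2 := by
  have h := inner_eq_sum b X X
  simp only [inner_self_eq_norm_sq_to_K] at h
  exact_mod_cast h

theorem norm_adjoint (X : E →ₗ[𝕜] F) : ‖X.adjoint‖ = ‖X‖ := by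
  have h : (‖X.adjoint‖ : 𝕜) ^ 2 = (‖X‖ : 𝕜) ^ 2 := by
    rw [← trace_adjoint_comp_self, ← trace_adjoint_comp_self, LinearMap.adjoint_adjoint,
      LinearMap.trace_comp_comm']
  exact (sq_eq_sq₀ (norm_nonneg _) (norm_nonneg _)).1 (by exact_mod_cast h)

theorem norm_adjoint_apply_le (X : E →ₗ[𝕜] F) (y : F) : ‖X.adjoint y‖ ≤ ‖X‖ * ‖y‖ := by
  refine (sq_le_sq₀ (norm_nonneg _) (by positivity)).1 ?_
  let b := stdOrthonormalBasis 𝕜 E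
  calc ‖X.adjoint y‖ ^ 2 = ∑ i, ‖⟪X (b i), y⟫_𝕜‖ ^ 2 := by
        simp_rw [← b.sum_sq_norm_inner_right, LinearMap.adjoint_inner_right]
    _ ≤ ∑ i, (‖X (b i)‖ * ‖y‖) ^ 2 := by gcongr; exact norm_inner_le_norm _ _
    _ = (‖X‖ * ‖y‖) ^ 2 := by simp only [mul_pow, norm_sq_eq_sum b X, Finset.sum_mul]

/-- The Gram operator `Y^* Y`. -/
def gram (Y : E →ₗ[𝕜] F) : E →ₗ[𝕜] E := Y.adjoint ∘ₗ Y

theorem trace_gram (Y : E →ₗ[𝕜] F) : LinearMap.trace 𝕜 E (gram Y) = (‖Y‖ : 𝕜) ^ 2 :=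
  trace_adjoint_comp_self Y

theorem adjoint_gram (Y : E →ₗ[𝕜] F) : (gram Y).adjoint = gram Y := by
  rw [gram, LinearMap.adjoint_comp, LinearMap.adjoint_adjoint]

theorem gram_zero : gram (0 : E →ₗ[𝕜] F) = 0 := by
  rw [gram, LinearMap.comp_zero]

theorem gram_smul (c : 𝕜) (Y : E →ₗ[𝕜] F) : gram (c • Y) = ((‖c‖ ^ 2 : ℝ) : 𝕜) • gram Y := by
  rw [gram, map_smulₛₗ, LinearMap.smul_comp, LinearMap.comp_smul, smul_smul, RCLike.conj_mul, gram,
    RCLike.ofReal_pow]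

theorem norm_gram_le (Y : E →ₗ[𝕜] F) : ‖gram Y‖ ≤ ‖Y‖ ^ 2 := by
  refine (sq_le_sq₀ (norm_nonneg _) (by positivity)).1 ?_
  let b := stdOrthonormalBasis 𝕜 E
  calc ‖gram Y‖ ^ 2 = ∑ i, ‖Y.adjoint (Y (b i))‖ ^ 2 := norm_sq_eq_sum b _
    _ ≤ ∑ i, (‖Y‖ * ‖Y (b i)‖) ^ 2 := by gcongr; exact norm_adjoint_apply_le Y _
    _ = (‖Y‖ ^ 2) ^ 2 := by
      simp only [mul_pow, ← Finset.mul_sum, ← norm_sq_eq_sum b Y]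
      ring

theorem continuous_comp_left (A : F →ₗ[𝕜] G) : Continuous fun Y : E →ₗ[𝕜] F => A ∘ₗ Y :=
  (LinearMap.llcomp 𝕜 E F G A).continuous_of_finiteDimensional

theorem continuous_gram : Continuous (gram : (E →ₗ[𝕜] F) → E →ₗ[𝕜] E) := by
  have hadjoint : Continuous (LinearMap.adjoint : (E →ₗ[𝕜] F) ≃ₗ⋆[𝕜] F →ₗ[𝕜] E) :=
    (AddMonoidHomClass.isometry_of_norm _ norm_adjoint).continuous
  let comp : (F →ₗ[𝕜] E) →L[𝕜] (E →ₗ[𝕜] F) →L[𝕜] E →ₗ[𝕜] E :=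
    (LinearMap.llcomp 𝕜 E F E).toContinuousBilinearMap
  exact comp.continuous₂.comp (hadjoint.prodMk continuous_id)

end HilbertSchmidt

section Parseval

variable {𝕜 J K V W U : Type*} [RCLike 𝕜]
  [NormedAddCommGroup V] [InnerProductSpace 𝕜 V] [NormedAddCommGroup W] [InnerProductSpace 𝕜 W]
  [NormedAddCommGroup U] [InnerProductSpace 𝕜 U]

/-- A Parseval family of operators: `x ↦ (T j x)_j` is an isometry into the `ℓ²`-sum, that is,
`∑ j, (T j)^* (T j) = 1`. -/
def IsParseval (T : J → V →ₗ[𝕜] W) : Prop :=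
  ∀ x, HasSum (fun j => ‖T j x‖ ^ 2) (‖x‖ ^ 2)

theorem IsParseval.hasSum_inner {T : J → V →ₗ[𝕜] W} (hT : IsParseval T) (x y : V) :
    HasSum (fun j => ⟪T j x, T j y⟫_𝕜) ⟪x, y⟫_𝕜 := by
  have h : ∀ z, HasSum (fun j => (‖T j z‖ : 𝕜) ^ 2) ((‖z‖ : 𝕜) ^ 2) := fun z => by
    simpa using RCLike.hasSum_ofReal 𝕜 |>.2 (hT z)
  simp only [inner_eq_sum_norm_sq_div_four, ← map_add, ← map_sub, ← map_smul]
  exact (((h _).sub (h _)).add (((h _).sub (h _)).mul_right _)).div_const _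

theorem IsParseval.comp {T : J → V →ₗ[𝕜] W} {S : K → U →ₗ[𝕜] V} (hT : IsParseval T)
    (hS : IsParseval S) : IsParseval fun p : K × J => T p.2 ∘ₗ S p.1 := by
  intro x
  have hinner : ∀ k, HasSum (fun j => ‖T j (S k x)‖ ^ 2) (‖S k x‖ ^ 2) := fun k => hT (S k x)
  have hsum : Summable fun p : K × J => ‖T p.2 (S p.1 x)‖ ^ 2 := by
    rw [summable_prod_of_nonneg fun _ => by positivity]
    refine ⟨fun k => (hinner k).summable, ?_⟩
    simpa only [(hinner _).tsum_eq] using (hS x).summable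
  have h := hsum.hasSum
  rwa [(h.prod_fiberwise hinner).unique (hS x)] at h

theorem IsParseval.postcomp {E : Type*} [NormedAddCommGroup E] [InnerProductSpace 𝕜 E]
    [FiniteDimensional 𝕜 E] [FiniteDimensional 𝕜 V] [FiniteDimensional 𝕜 W] {T : J → V →ₗ[𝕜] W}
    (hT : IsParseval T) :
    IsParseval fun j => (LinearMap.llcomp 𝕜 E V W (T j) : (E →ₗ[𝕜] V) →ₗ[𝕜] E →ₗ[𝕜] W) := by
  intro Y
  let b := stdOrthonormalBasis 𝕜 E
  simp only [norm_sq_eq_sum b]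
  exact hasSum_sum fun i _ => hT (Y (b i))

end Parseval

section Purity

variable {𝕜 E F G : Type*} [RCLike 𝕜]
  [NormedAddCommGroup E] [InnerProductSpace 𝕜 E] [FiniteDimensional 𝕜 E]
  [NormedAddCommGroup F] [InnerProductSpace 𝕜 F] [FiniteDimensional 𝕜 F]
  [NormedAddCommGroup G] [InnerProductSpace 𝕜 G] [FiniteDimensional 𝕜 G]

/-- The purity `tr σ²` of the normalised state `σ = Y Y^* / tr (Y Y^*)`, expressed by the Gram
operator `Y^* Y`, which has the same nonzero spectrum as `Y Y^*`. It is `0` at `Y = 0`. -/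
def purity (Y : E →ₗ[𝕜] F) : ℝ := ‖gram Y‖ ^ 2 / ‖Y‖ ^ 4

/-- The deviation of the Gram operator of `A Y` from the multiple of the Gram operator of `Y` with
the same trace, normalised to be invariant under scaling of `Y`. It vanishes at `Y = 0`. -/
def defect (A : F →ₗ[𝕜] G) (Y : E →ₗ[𝕜] F) : ℝ :=
  ‖gram (A ∘ₗ Y) - ((‖A ∘ₗ Y‖ ^ 2 / ‖Y‖ ^ 2 : ℝ) : 𝕜) • gram Y‖ ^ 2 / ‖Y‖ ^ 4

theorem purity_nonneg (Y : E →ₗ[𝕜] F) : 0 ≤ purity Y := by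
  unfold purity
  positivity

theorem purity_le_one (Y : E →ₗ[𝕜] F) : purity Y ≤ 1 := by
  refine div_le_one_of_le₀ ?_ (by positivity)
  calc ‖gram Y‖ ^ 2 ≤ (‖Y‖ ^ 2) ^ 2 := by gcongr; exact norm_gram_le Y
    _ = ‖Y‖ ^ 4 := by ring

theorem defect_nonneg (A : F →ₗ[𝕜] G) (Y : E →ₗ[𝕜] F) : 0 ≤ defect A Y := by
  unfold defect
  positivity

theorem gram_comp_eq_smul_of_defect_eq_zero {A : F →ₗ[𝕜] G} {Y : E →ₗ[𝕜] F} (hY : Y ≠ 0)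
    (h : defect A Y = 0) : gram (A ∘ₗ Y) = ((‖A ∘ₗ Y‖ ^ 2 / ‖Y‖ ^ 2 : ℝ) : 𝕜) • gram Y := by
  rw [defect, div_eq_zero_iff, or_iff_left (pow_ne_zero _ (norm_ne_zero_iff.2 hY)),
    sq_eq_zero_iff, norm_eq_zero] at h
  exact sub_eq_zero.1 h

theorem inner_self_comp (Y : E →ₗ[𝕜] F) (B : E →ₗ[𝕜] E) : ⟪Y, Y ∘ₗ B⟫_𝕜 = ⟪gram Y, B⟫_𝕜 := by
  rw [inner_eq_trace, inner_eq_trace, adjoint_gram, gram, LinearMap.comp_assoc]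

theorem IsParseval.hasSum_inner_gram {J : Type*} {T : J → F →ₗ[𝕜] G} (hT : IsParseval T)
    (Y : E →ₗ[𝕜] F) (B : E →ₗ[𝕜] E) :
    HasSum (fun j => ⟪gram (T j ∘ₗ Y), B⟫_𝕜) ⟪gram Y, B⟫_𝕜 := by
  simp only [← inner_self_comp]
  exact hT.postcomp.hasSum_inner Y (Y ∘ₗ B)

theorem IsParseval.norm_comp_le {J : Type*} {T : J → F →ₗ[𝕜] G} (hT : IsParseval T)
    (Y : E →ₗ[𝕜] F) (j : J) : ‖T j ∘ₗ Y‖ ≤ ‖Y‖ :=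
  (sq_le_sq₀ (norm_nonneg _) (norm_nonneg _)).1 <|
    le_hasSum (hT.postcomp Y) j fun _ _ => sq_nonneg _

/-- The map `B ↦ ‖B‖² / tr B` is convex on positive operators; the left side without the defect is
its tangent at `gram Y`, evaluated at `gram (A ∘ₗ Y)`. -/
theorem tangent_add_defect_le {A : F →ₗ[𝕜] G} {Y : E →ₗ[𝕜] F} (hY : Y ≠ 0) (hA : ‖A ∘ₗ Y‖ ≤ ‖Y‖) :
    2 / ‖Y‖ ^ 2 * RCLike.re ⟪gram (A ∘ₗ Y), gram Y⟫_𝕜 - ‖A ∘ₗ Y‖ ^ 2 * purity Y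
      + ‖Y‖ ^ 2 * defect A Y ≤ ‖A ∘ₗ Y‖ ^ 2 * purity (A ∘ₗ Y) := by
  rcases eq_or_ne (A ∘ₗ Y) 0 with hAY | hAY
  · simp [hAY, gram_zero, defect]
  have := norm_pos_iff.2 hY
  have := norm_pos_iff.2 hAY
  obtain ⟨c, hc⟩ : ∃ c, c = ‖A ∘ₗ Y‖ ^ 2 / ‖Y‖ ^ 2 := ⟨_, rfl⟩
  obtain ⟨u, hu⟩ : ∃ u, u = RCLike.re ⟪gram (A ∘ₗ Y), gram Y⟫_𝕜 := ⟨_, rfl⟩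
  have deviation : ‖gram (A ∘ₗ Y) - (c : 𝕜) • gram Y‖ ^ 2
      = ‖gram (A ∘ₗ Y)‖ ^ 2 - 2 * (c * u) + c ^ 2 * ‖gram Y‖ ^ 2 := by
    rw [@norm_sub_sq 𝕜, inner_smul_right, RCLike.re_ofReal_mul, norm_smul, mul_pow,
      RCLike.norm_ofReal, sq_abs, hu]
  calc 2 / ‖Y‖ ^ 2 * RCLike.re ⟪gram (A ∘ₗ Y), gram Y⟫_𝕜 - ‖A ∘ₗ Y‖ ^ 2 * purity Y
        + ‖Y‖ ^ 2 * defect A Y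
      = 2 / ‖Y‖ ^ 2 * u - ‖A ∘ₗ Y‖ ^ 2 * purity Y
        + ‖gram (A ∘ₗ Y) - (c : 𝕜) • gram Y‖ ^ 2 / ‖Y‖ ^ 2 := by
        rw [defect, ← hc, ← hu]
        field_simp
    _ ≤ 2 / ‖Y‖ ^ 2 * u - ‖A ∘ₗ Y‖ ^ 2 * purity Y
        + ‖gram (A ∘ₗ Y) - (c : 𝕜) • gram Y‖ ^ 2 / ‖A ∘ₗ Y‖ ^ 2 := by gcongr
    _ = ‖A ∘ₗ Y‖ ^ 2 * purity (A ∘ₗ Y) := by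
        rw [deviation, hc, purity, purity]
        field_simp
        ring

theorem IsParseval.summable_norm_sq_mul_purity {J : Type*} {T : J → F →ₗ[𝕜] G}
    (hT : IsParseval T) (Y : E →ₗ[𝕜] F) :
    Summable fun j => ‖T j ∘ₗ Y‖ ^ 2 * purity (T j ∘ₗ Y) :=
  (hT.postcomp Y).summable.of_nonneg_of_le (fun _ => mul_nonneg (sq_nonneg _) (purity_nonneg _))
    fun _ => mul_le_of_le_one_right (sq_nonneg _) (purity_le_one _)

theorem IsParseval.norm_sq_mul_purity_add_defect_le {J : Type*} {T : J → F →ₗ[𝕜] G}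
    (hT : IsParseval T) (Y : E →ₗ[𝕜] F) (j₀ : J) :
    ‖Y‖ ^ 2 * (purity Y + defect (T j₀) Y) ≤ ∑' j, ‖T j ∘ₗ Y‖ ^ 2 * purity (T j ∘ₗ Y) := by
  classical
  rcases eq_or_ne Y 0 with rfl | hY
  · simp
  have hnorm : HasSum (fun j => ‖T j ∘ₗ Y‖ ^ 2) (‖Y‖ ^ 2) := hT.postcomp Y
  have htangent : HasSum (fun j => 2 / ‖Y‖ ^ 2 * RCLike.re ⟪gram (T j ∘ₗ Y), gram Y⟫_𝕜
      - ‖T j ∘ₗ Y‖ ^ 2 * purity Y) (‖Y‖ ^ 2 * purity Y) := by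
    have h := ((RCLike.hasSum_re 𝕜 (hT.hasSum_inner_gram Y (gram Y))).mul_left
      (2 / ‖Y‖ ^ 2)).sub (hnorm.mul_right (purity Y))
    have := norm_pos_iff.2 hY
    have hvalue : 2 / ‖Y‖ ^ 2 * RCLike.re ⟪gram Y, gram Y⟫_𝕜 - ‖Y‖ ^ 2 * purity Y
        = ‖Y‖ ^ 2 * purity Y := by
      rw [inner_self_eq_norm_sq, purity]
      field_simp
      ring
    rwa [hvalue] at h
  rw [mul_add]
  refine hasSum_le (fun j => ?_)
    (htangent.add (hasSum_ite_eq j₀ (‖Y‖ ^ 2 * defect (T j₀) Y)))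
    (hT.summable_norm_sq_mul_purity Y).hasSum
  refine le_trans ?_ (tangent_add_defect_le hY (hT.norm_comp_le Y j))
  gcongr
  split_ifs with h
  · rw [h]
  · exact mul_nonneg (sq_nonneg _) (defect_nonneg _ _)

end Purity

section Limit

variable {𝕜 E F G : Type*} [RCLike 𝕜]
  [NormedAddCommGroup E] [InnerProductSpace 𝕜 E] [FiniteDimensional 𝕜 E]
  [NormedAddCommGroup F] [InnerProductSpace 𝕜 F] [FiniteDimensional 𝕜 F]
  [NormedAddCommGroup G] [InnerProductSpace 𝕜 G] [FiniteDimensional 𝕜 G]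

theorem purity_eq_of_gram_eq_smul {Y : E →ₗ[𝕜] F} {Z : E →ₗ[𝕜] G} {c : 𝕜}
    (h : gram Z = c • gram Y) (hZ : Z ≠ 0) : purity Z = purity Y := by
  have htrace : ‖Z‖ ^ 2 = ‖c‖ * ‖Y‖ ^ 2 := by
    simpa [trace_gram] using congrArg (fun T => ‖LinearMap.trace 𝕜 E T‖) h
  have hc : ‖c‖ ≠ 0 := fun hc => hZ (by simpa [hc] using htrace)
  calc purity Z = (‖c‖ * ‖gram Y‖) ^ 2 / (‖Z‖ ^ 2) ^ 2 := by
        rw [purity, h, norm_smul, ← pow_mul]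
    _ = purity Y := by
        rw [htrace, purity]
        field_simp

theorem purity_smul {c : 𝕜} (hc : c ≠ 0) {Y : E →ₗ[𝕜] F} (hY : Y ≠ 0) :
    purity (c • Y) = purity Y :=
  purity_eq_of_gram_eq_smul (gram_smul c Y) (smul_ne_zero hc hY)

theorem defect_smul {c : 𝕜} (hc : c ≠ 0) (A : F →ₗ[𝕜] G) (Y : E →ₗ[𝕜] F) :
    defect A (c • Y) = defect A Y := by
  have hc' : ‖c‖ ≠ 0 := norm_ne_zero_iff.2 hc
  have hratio : ‖A ∘ₗ (c • Y)‖ ^ 2 / ‖c • Y‖ ^ 2 = ‖A ∘ₗ Y‖ ^ 2 / ‖Y‖ ^ 2 := by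
    rw [LinearMap.comp_smul, norm_smul, norm_smul]
    field_simp
  rw [defect, hratio, LinearMap.comp_smul, gram_smul, gram_smul, smul_comm, ← smul_sub, norm_smul,
    norm_smul, RCLike.norm_ofReal, abs_of_nonneg (by positivity), defect]
  field_simp

theorem continuousAt_purity {X : E →ₗ[𝕜] F} (hX : X ≠ 0) :
    ContinuousAt (purity : (E →ₗ[𝕜] F) → ℝ) X :=
  (continuous_gram.norm.pow 2).continuousAt.div (continuous_norm.pow 4).continuousAt
    (pow_ne_zero _ (norm_ne_zero_iff.2 hX))

theorem continuousAt_defect (A : F →ₗ[𝕜] G) {X : E →ₗ[𝕜] F} (hX : X ≠ 0) :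
    ContinuousAt (defect A : (E →ₗ[𝕜] F) → ℝ) X := by
  have hX' : ‖X‖ ≠ 0 := norm_ne_zero_iff.2 hX
  have hcomp : Continuous fun Y : E →ₗ[𝕜] F => A ∘ₗ Y := continuous_comp_left A
  have hratio : ContinuousAt (fun Y : E →ₗ[𝕜] F => ‖A ∘ₗ Y‖ ^ 2 / ‖Y‖ ^ 2) X :=
    (hcomp.norm.pow 2).continuousAt.div (continuous_norm.pow 2).continuousAt (pow_ne_zero _ hX')
  have hratio' : ContinuousAt
      (fun Y : E →ₗ[𝕜] F => ((‖A ∘ₗ Y‖ ^ 2 / ‖Y‖ ^ 2 : ℝ) : 𝕜)) X :=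
    RCLike.continuous_ofReal.continuousAt.comp hratio
  have hdeviation : ContinuousAt (fun Y : E →ₗ[𝕜] F =>
      gram (A ∘ₗ Y) - ((‖A ∘ₗ Y‖ ^ 2 / ‖Y‖ ^ 2 : ℝ) : 𝕜) • gram Y) X :=
    (continuous_gram.comp hcomp).continuousAt.sub (hratio'.smul continuous_gram.continuousAt)
  exact (hdeviation.norm.pow 2).div (continuous_norm.pow 4).continuousAt (pow_ne_zero _ hX')

theorem tendsto_purity_one_of_tendsto_defect {ι α : Type*} {A : ι → F →ₗ[𝕜] G}
    (hA : ∀ X : E →ₗ[𝕜] F, X ≠ 0 → (∀ i, defect (A i) X = 0) → purity X = 1)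
    {l : Filter α} {Y : α → E →ₗ[𝕜] F} (hY : ∀ᶠ n in l, Y n ≠ 0)
    (hdefect : ∀ i, Tendsto (fun n => defect (A i) (Y n)) l (𝓝 0)) :
    Tendsto (fun n => purity (Y n)) l (𝓝 1) := by
  have := FiniteDimensional.proper_rclike 𝕜 (E →ₗ[𝕜] F)
  let unit : α → E →ₗ[𝕜] F := fun n => ((‖Y n‖ : 𝕜)⁻¹) • Y n
  have hscale : ∀ n, Y n ≠ 0 → (‖Y n‖ : 𝕜)⁻¹ ≠ 0 := by simp
  refine tendsto_iff_ultrafilter _ _ _ |>.2 fun u hu => ?_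
  have hYu : ∀ᶠ n in u, Y n ≠ 0 := hu hY
  have hsphere : ∀ᶠ n in u, unit n ∈ Metric.sphere (0 : E →ₗ[𝕜] F) 1 := by
    filter_upwards [hYu] with n hn
    simp [unit, norm_smul, hn]
  obtain ⟨X, hX, hXlim⟩ := (isCompact_sphere (0 : E →ₗ[𝕜] F) 1).ultrafilter_le_nhds (u.map unit)
    (le_principal_iff.2 hsphere)
  have hX0 : X ≠ 0 := ne_zero_of_mem_unit_sphere ⟨X, hX⟩
  have hunit : Tendsto unit u (𝓝 X) := hXlim
  have hXdefect : ∀ i, defect (A i) X = 0 := fun i => by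
    refine tendsto_nhds_unique_of_eventuallyEq ((continuousAt_defect (A i) hX0).tendsto.comp hunit)
      ((hdefect i).mono_left hu) ?_
    filter_upwards [hYu] with n hn using defect_smul (hscale n hn) (A i) (Y n)
  rw [← hA X hX0 hXdefect]
  refine ((continuousAt_purity hX0).tendsto.comp hunit).congr' ?_
  filter_upwards [hYu] with n hn using purity_smul (hscale n hn) hn

end Limit

section RankOne

variable {𝕜 E F : Type*} [RCLike 𝕜]
  [NormedAddCommGroup E] [InnerProductSpace 𝕜 E] [FiniteDimensional 𝕜 E]
  [NormedAddCommGroup F] [InnerProductSpace 𝕜 F] [FiniteDimensional 𝕜 F]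

theorem purity_eq_one_of_finrank_range_le_one {X : E →ₗ[𝕜] F} (hX : X ≠ 0)
    (hrank : Module.finrank 𝕜 (LinearMap.range X) ≤ 1) : purity X = 1 := by
  obtain ⟨v, hv⟩ := finrank_le_one_iff.1 hrank
  choose c hc using fun x => hv ⟨X x, x, rfl⟩
  have hXc : ∀ x, X x = c x • (v : F) := fun x => (congrArg Subtype.val (hc x)).symm
  let b := stdOrthonormalBasis 𝕜 E
  have hnorm : ‖X‖ ^ 2 = (∑ i, ‖c (b i)‖ ^ 2) * ‖(v : F)‖ ^ 2 := by
    simp only [norm_sq_eq_sum b, hXc, norm_smul, mul_pow, Finset.sum_mul]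
  have hadjoint : ‖X.adjoint v‖ ^ 2 = (∑ i, ‖c (b i)‖ ^ 2) * ‖(v : F)‖ ^ 4 := by
    simp_rw [← b.sum_sq_norm_inner_right, LinearMap.adjoint_inner_right, hXc, inner_smul_left,
      norm_mul, RCLike.norm_conj, inner_self_eq_norm_sq_to_K, norm_pow, RCLike.norm_ofReal,
      abs_norm, Finset.sum_mul, mul_pow, ← pow_mul]
  have hgram : ‖gram X‖ ^ 2 = (∑ i, ‖c (b i)‖ ^ 2) * ‖X.adjoint v‖ ^ 2 := by
    simp only [norm_sq_eq_sum b, gram, LinearMap.comp_apply, hXc, map_smul, norm_smul, mul_pow,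
      Finset.sum_mul]
  have hsquare : ‖gram X‖ ^ 2 = ‖X‖ ^ 4 := by
    rw [hgram, hadjoint, show ‖X‖ ^ 4 = (‖X‖ ^ 2) ^ 2 by ring, hnorm]
    ring
  rw [purity, hsquare, div_self (pow_ne_zero _ (norm_ne_zero_iff.2 hX))]

theorem starProjection_comp_comp_starProjection_range {X : E →ₗ[𝕜] F} {T : F →ₗ[𝕜] F} {c : 𝕜}
    (h : X.adjoint ∘ₗ T ∘ₗ X = c • gram X) :
    (LinearMap.range X).starProjection.toLinearMap ∘ₗ T ∘ₗ
      (LinearMap.range X).starProjection.toLinearMap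
        = c • (LinearMap.range X).starProjection.toLinearMap := by
  set P := (LinearMap.range X).starProjection
  have hP : ∀ y z, ⟪y, P z⟫_𝕜 = ⟪P y, P z⟫_𝕜 := fun y z => by
    rw [Submodule.inner_starProjection_left_eq_right, Submodule.starProjection_eq_self_iff.2
      (Submodule.starProjection_apply_mem _ z)]
  ext z
  refine ext_inner_left 𝕜 fun y => ?_
  obtain ⟨x, hx⟩ : P y ∈ LinearMap.range X := Submodule.starProjection_apply_mem _ y
  obtain ⟨x', hx'⟩ : P z ∈ LinearMap.range X := Submodule.starProjection_apply_mem _ z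
  calc ⟪y, P (T (P z))⟫_𝕜 = ⟪x, (X.adjoint ∘ₗ T ∘ₗ X) x'⟫_𝕜 := by
        simp only [LinearMap.comp_apply, LinearMap.adjoint_inner_right, hx, hx',
          P, Submodule.inner_starProjection_left_eq_right]
    _ = c * ⟪P y, P z⟫_𝕜 := by
        rw [h, gram, LinearMap.smul_apply, inner_smul_right, LinearMap.comp_apply,
          LinearMap.adjoint_inner_right, hx, hx']
    _ = ⟪y, c • P z⟫_𝕜 := by rw [inner_smul_right, ← hP]

end RankOne

section Words

variable {I H : Type*} [NormedAddCommGroup H] [InnerProductSpace ℂ H]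

theorem prodRL_append (a : I → Module.End ℂ H) {m n : ℕ} (w : Fin m → I) (v : Fin n → I) :
    prodRL a (Fin.append w v) = prodRL a v * prodRL a w := by
  have h : (fun k => a (Fin.append w v k)) = Fin.append (fun k => a (w k)) fun k => a (v k) := by
    ext k : 1
    refine Fin.addCases (fun k => ?_) (fun k => ?_) k <;> simp
  simp [prodRL, h, List.ofFn_fin_append]

theorem prodLR_comp_rev (a : I → Module.End ℂ H) {n : ℕ} (w : Fin n → I) :
    prodLR a (w ∘ Fin.rev) = prodRL a w := by
  rw [prodLR, prodRL]
  congr 1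
  refine List.ext_getElem (by simp) fun k hk _ => ?_
  rw [List.length_ofFn] at hk
  simp only [List.getElem_reverse, List.getElem_ofFn, List.length_ofFn, Function.comp_apply]
  congr 2
  ext
  simp only [Fin.val_rev]
  omega

variable [FiniteDimensional ℂ H] {a : I → Module.End ℂ H}

theorem IsKraus.isParseval (ha : IsKraus a) : IsParseval a := by
  intro x
  have h := Complex.hasSum_re ((ha x).mapL (innerSL ℂ x))
  simpa [LinearMap.adjoint_inner_right, inner_self_eq_norm_sq_to_K, ← Complex.ofReal_pow] using h

theorem IsKraus.isParseval_prodRL (ha : IsKraus a) (n : ℕ) :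
    IsParseval fun w : Fin n → I => prodRL a w := by
  induction n with
  | zero =>
    intro x
    simp [prodRL]
  | succ n ih =>
    intro x
    let e : (Fin n → I) × I ≃ (Fin (n + 1) → I) :=
      (Equiv.prodComm _ _).trans (Fin.snocEquiv fun _ => I)
    have he : ∀ p, prodRL a (e p) = a p.2 ∘ₗ prodRL a p.1 := fun p => prodRL_snoc a p.1 p.2
    rw [← e.hasSum_iff]
    simpa only [Function.comp_def, he] using ha.isParseval.comp ih x

end Words

section DarkOfDefect

variable {I E H : Type*} [NormedAddCommGroup H] [InnerProductSpace ℂ H] [FiniteDimensional ℂ H]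
  [NormedAddCommGroup E] [InnerProductSpace ℂ E] [FiniteDimensional ℂ E]

theorem exists_isDark {a : I → Module.End ℂ H} {X : E →ₗ[ℂ] H} (hX : X ≠ 0) (hpurity : purity X ≠ 1)
    (hdefect : ∀ (n : ℕ) (w : Fin n → I), defect (prodRL a w) X = 0) :
    ∃ p : Module.End ℂ H, IsDark a p := by
  let K := LinearMap.range X
  have hproj : (K.starProjection : Module.End ℂ H).IsSymmetricProjection :=
    LinearMap.isSymmetricProjection_iff_eq_coe_starProjection.2 ⟨K, inferInstance, rfl⟩
  have hrank : 2 ≤ Module.finrank ℂ K := by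
    by_contra! hlt
    exact hpurity (purity_eq_one_of_finrank_range_le_one hX (Nat.lt_succ_iff.1 hlt))
  refine ⟨K.starProjection, hproj, by rwa [K.range_starProjection], fun n _ w => ?_⟩
  have hw : prodLR a w = prodRL a (w ∘ Fin.rev) := by
    rw [← prodLR_comp_rev, Function.comp_assoc, Fin.rev_involutive.comp_self, Function.comp_id]
  have hgram := gram_comp_eq_smul_of_defect_eq_zero hX (hdefect n (w ∘ Fin.rev))
  refine ⟨‖prodRL a (w ∘ Fin.rev) ∘ₗ X‖ ^ 2 / ‖X‖ ^ 2, by positivity, ?_⟩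
  rw [hw, mul_assoc, mul_assoc, ← mul_assoc (LinearMap.adjoint _)]
  refine starProjection_comp_comp_starProjection_range (Eq.trans ?_ hgram)
  rw [gram, LinearMap.adjoint_comp]
  rfl

end DarkOfDefect

theorem tsum_le_of_add_le_shift {m d : ℕ → ℝ≥0∞} {k : ℕ} (hm : ∀ n, m n ≤ 1)
    (h : ∀ n, m n + d n ≤ m (n + k)) : ∑' n, d n ≤ k := by
  refine ENNReal.tsum_le_of_sum_range_le fun N => ?_
  have hfinite : ∑ n ∈ Finset.range N, m n ≠ ∞ :=
    ENNReal.sum_ne_top.2 fun n _ => ((hm n).trans_lt ENNReal.one_lt_top).ne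
  refine (ENNReal.add_le_add_iff_left hfinite).1 ?_
  calc ∑ n ∈ Finset.range N, m n + ∑ n ∈ Finset.range N, d n
      ≤ ∑ n ∈ Finset.range N, m (n + k) := by
        rw [← Finset.sum_add_distrib]
        exact Finset.sum_le_sum fun n _ => h n
    _ ≤ ∑ n ∈ Finset.range (N + k), m n := by
        simp_rw [add_comm N k, Finset.sum_range_add, add_comm k]
        exact le_add_self
    _ = ∑ n ∈ Finset.range N, m n + ∑ n ∈ Finset.range k, m (N + n) := Finset.sum_range_add _ _ _
    _ ≤ ∑ n ∈ Finset.range N, m n + k := by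
        gcongr
        simpa using Finset.sum_le_sum fun n (_ : n ∈ Finset.range k) => hm (N + n)

section Outcomes

variable {I : Type*}

/-- The word `(ω_1,…,ω_n)` of the first `n` outcomes. -/
def firstOutcomes (n : ℕ) (ω : ℕ → I) : Fin n → I := fun k => ω k

variable [MeasurableSpace I]

theorem measurable_firstOutcomes (n : ℕ) :
    Measurable (firstOutcomes n : (ℕ → I) → Fin n → I) :=
  measurable_pi_lambda _ fun _ => measurable_pi_apply _

variable [DiscreteMeasurableSpace I] [Countable I]

theorem lintegral_firstOutcomes (P : Measure (ℕ → I)) {n : ℕ} (f : (Fin n → I) → ℝ≥0∞) :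
    ∫⁻ ω, f (firstOutcomes n ω) ∂P = ∑' w, f w * P (cyl w) := by
  have hcyl : ∀ w : Fin n → I, firstOutcomes n ⁻¹' {w} = cyl w := fun w => by
    ext ω
    simp [cyl, firstOutcomes, funext_iff]
  rw [← lintegral_map (measurable_of_countable f) (measurable_firstOutcomes n),
    lintegral_countable']
  simp_rw [Measure.map_apply (measurable_firstOutcomes n) (measurableSet_singleton _), hcyl]

end Outcomes

section Law

variable {I E H : Type*} [NormedAddCommGroup H] [InnerProductSpace ℂ H] [FiniteDimensional ℂ H]
  [NormedAddCommGroup E] [InnerProductSpace ℂ E] [FiniteDimensional ℂ E]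

/-- The random operator `Y_n = a_{ω_n} ⋯ a_{ω_1} R`. When the initial state is factored as
`ρ = R R^*`, the trajectory is `ρ_n = Y_n Y_n^* / tr (Y_n Y_n^*)`. -/
def factorTrajectory (a : I → Module.End ℂ H) (R : E →ₗ[ℂ] H) (n : ℕ) (ω : ℕ → I) : E →ₗ[ℂ] H :=
  prodRL a (firstOutcomes n ω) ∘ₗ R

theorem outcomeWeight_comp_adjoint (a : I → Module.End ℂ H) (R : E →ₗ[ℂ] H) {n : ℕ}
    (w : Fin n → I) : outcomeWeight a (R ∘ₗ R.adjoint) w = (‖prodRL a w ∘ₗ R‖ : ℂ) ^ 2 := by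
  rw [outcomeWeight_eq]
  refine Eq.trans ?_ (trace_adjoint_comp_self (prodRL a w ∘ₗ R))
  rw [LinearMap.trace_comp_comm', LinearMap.adjoint_comp]
  rfl

variable [MeasurableSpace I] {a : I → Module.End ℂ H} {R : E →ₗ[ℂ] H} {P : Measure (ℕ → I)}

theorem IsOutcomeLaw.measure_cyl (hP : IsOutcomeLaw a (R ∘ₗ R.adjoint) P) {n : ℕ} (w : Fin n → I) :
    P (cyl w) = ENNReal.ofReal (‖prodRL a w ∘ₗ R‖ ^ 2) := by
  rw [hP.2, outcomeWeight_comp_adjoint, ← Complex.ofReal_pow, Complex.ofReal_re]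

variable [Countable I]

theorem IsOutcomeLaw.ae_factorTrajectory_ne_zero (hP : IsOutcomeLaw a (R ∘ₗ R.adjoint) P) :
    ∀ᵐ ω ∂P, ∀ n, factorTrajectory a R n ω ≠ 0 := by
  refine ae_all_iff.2 fun n => ?_
  have hword : ∀ w : Fin n → I, ∀ᵐ ω ∂P, ω ∈ cyl w → prodRL a w ∘ₗ R ≠ 0 := fun w => by
    by_cases hw : prodRL a w ∘ₗ R = 0
    · have hnull : P (cyl w) = 0 := by simp [hP.measure_cyl, hw]
      filter_upwards [measure_eq_zero_iff_ae_notMem.1 hnull] with ω hω hmem using absurd hmem hω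
    · exact ae_of_all _ fun _ _ => hw
  filter_upwards [ae_all_iff.2 hword] with ω hω using hω (firstOutcomes n ω) fun _ => rfl

variable [DiscreteMeasurableSpace I]

theorem IsOutcomeLaw.lintegral_factorTrajectory (hP : IsOutcomeLaw a (R ∘ₗ R.adjoint) P) (n : ℕ)
    (f : (E →ₗ[ℂ] H) → ℝ) :
    ∫⁻ ω, ENNReal.ofReal (f (factorTrajectory a R n ω)) ∂P
      = ∑' w : Fin n → I, ENNReal.ofReal (‖prodRL a w ∘ₗ R‖ ^ 2 * f (prodRL a w ∘ₗ R)) := by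
  simp only [factorTrajectory]
  rw [lintegral_firstOutcomes P fun w => ENNReal.ofReal (f (prodRL a w ∘ₗ R))]
  refine tsum_congr fun w => ?_
  rw [hP.measure_cyl, mul_comm, ENNReal.ofReal_mul (sq_nonneg _)]

theorem IsOutcomeLaw.lintegral_purity_add_lintegral_defect_le (ha : IsKraus a)
    (hP : IsOutcomeLaw a (R ∘ₗ R.adjoint) P) (n : ℕ) {k : ℕ} (v : Fin k → I) :
    ∫⁻ ω, ENNReal.ofReal (purity (factorTrajectory a R n ω)) ∂P
        + ∫⁻ ω, ENNReal.ofReal (defect (prodRL a v) (factorTrajectory a R n ω)) ∂P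
      ≤ ∫⁻ ω, ENNReal.ofReal (purity (factorTrajectory a R (n + k) ω)) ∂P := by
  have hT := ha.isParseval_prodRL k
  have purity_add_defect_le : ∀ Y : E →ₗ[ℂ] H,
      ENNReal.ofReal (‖Y‖ ^ 2 * purity Y) + ENNReal.ofReal (‖Y‖ ^ 2 * defect (prodRL a v) Y)
        ≤ ∑' u : Fin k → I, ENNReal.ofReal (‖prodRL a u ∘ₗ Y‖ ^ 2 * purity (prodRL a u ∘ₗ Y)) := by
    intro Y
    rw [← ENNReal.ofReal_add (mul_nonneg (sq_nonneg _) (purity_nonneg _))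
        (mul_nonneg (sq_nonneg _) (defect_nonneg _ _)), ← mul_add,
      ← ENNReal.ofReal_tsum_of_nonneg (fun _ => mul_nonneg (sq_nonneg _) (purity_nonneg _))
        (hT.summable_norm_sq_mul_purity Y)]
    exact ENNReal.ofReal_le_ofReal (hT.norm_sq_mul_purity_add_defect_le Y v)
  rw [hP.lintegral_factorTrajectory, hP.lintegral_factorTrajectory n (defect (prodRL a v)),
    hP.lintegral_factorTrajectory, ← ENNReal.tsum_add, ← (Fin.appendEquiv n k).tsum_eq,
    ENNReal.tsum_prod']
  refine ENNReal.tsum_le_tsum fun w => (purity_add_defect_le _).trans_eq ?_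
  simp only [Fin.appendEquiv, Equiv.coe_fn_mk, prodRL_append, Module.End.mul_eq_comp,
    LinearMap.comp_assoc]

theorem IsOutcomeLaw.ae_tendsto_defect (ha : IsKraus a) (hP : IsOutcomeLaw a (R ∘ₗ R.adjoint) P)
    {k : ℕ} (v : Fin k → I) :
    ∀ᵐ ω ∂P, Tendsto (fun n => defect (prodRL a v) (factorTrajectory a R n ω)) atTop (𝓝 0) := by
  have := hP.1
  let d : ℕ → (ℕ → I) → ℝ≥0∞ := fun n ω =>
    ENNReal.ofReal (defect (prodRL a v) (factorTrajectory a R n ω))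
  have hd : ∀ n, Measurable (d n) := fun n =>
    (measurable_of_countable fun w : Fin n → I =>
      ENNReal.ofReal (defect (prodRL a v) (prodRL a w ∘ₗ R))).comp
      (measurable_firstOutcomes n)
  have hpurity : ∀ n, ∫⁻ ω, ENNReal.ofReal (purity (factorTrajectory a R n ω)) ∂P ≤ 1 := fun n =>
    (lintegral_mono fun _ => ENNReal.ofReal_le_one.2 (purity_le_one _)).trans (by simp)
  have hsum : ∫⁻ ω, ∑' n, d n ω ∂P ≤ k := by
    rw [lintegral_tsum fun n => (hd n).aemeasurable]
    exact tsum_le_of_add_le_shift hpurity fun n =>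
      hP.lintegral_purity_add_lintegral_defect_le ha n v
  filter_upwards [ae_lt_top (Measurable.tsum hd)
    (hsum.trans_lt (ENNReal.natCast_lt_top k)).ne] with ω hω
  have h := (ENNReal.tendsto_toReal ENNReal.zero_ne_top).comp
    (ENNReal.tendsto_atTop_zero_of_tsum_ne_top hω.ne)
  simpa [d, Function.comp_def, ENNReal.toReal_ofReal (defect_nonneg _ _)] using h

end Law

section Purification

variable {I E H : Type*} [NormedAddCommGroup H] [InnerProductSpace ℂ H] [FiniteDimensional ℂ H]
  [NormedAddCommGroup E] [InnerProductSpace ℂ E] [FiniteDimensional ℂ E]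

theorem exists_eq_comp_adjoint {ρ : Module.End ℂ H} (hρ : ρ.IsPositive) :
    ∃ R : Module.End ℂ H, ρ = R ∘ₗ LinearMap.adjoint R := by
  have := FiniteDimensional.complete ℂ H
  have hnonneg : 0 ≤ LinearMap.toContinuousLinearMap ρ :=
    (ContinuousLinearMap.nonneg_iff_isPositive _).2
      ((LinearMap.isPositive_toContinuousLinearMap_iff ρ).2 hρ)
  obtain ⟨S, hS⟩ := CStarAlgebra.nonneg_iff_eq_mul_star_self.1 hnonneg
  refine ⟨S.toLinearMap, ?_⟩
  ext x
  exact congrArg (fun T : H →L[ℂ] H => T x) hS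

theorem linearEntropy_inv_smul_comp_adjoint {Y : E →ₗ[ℂ] H} (hY : Y ≠ 0) :
    linearEntropy (((‖Y‖ : ℂ) ^ 2)⁻¹ • (Y ∘ₗ Y.adjoint)) = 1 - purity Y := by
  have hY' : (‖Y‖ : ℂ) ≠ 0 := by simpa
  have htrace : LinearMap.trace ℂ H (Y ∘ₗ Y.adjoint) = (‖Y‖ : ℂ) ^ 2 := by
    rw [LinearMap.trace_comp_comm']
    exact trace_adjoint_comp_self Y
  have hsquare : LinearMap.trace ℂ H ((Y ∘ₗ Y.adjoint) * (Y ∘ₗ Y.adjoint))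
      = (‖gram Y‖ : ℂ) ^ 2 := by
    refine Eq.trans ?_ (trace_adjoint_comp_self (gram Y))
    rw [adjoint_gram, Module.End.mul_eq_comp, LinearMap.comp_assoc, LinearMap.trace_comp_comm']
    rfl
  rw [linearEntropy, mul_sub, mul_one, smul_mul_smul_comm, map_sub, map_smul, map_smul, htrace,
    hsquare, smul_eq_mul, smul_eq_mul, inv_mul_cancel₀ (pow_ne_zero 2 hY'), purity,
    ← Complex.ofReal_inj, ← Complex.ofReal_one]
  norm_cast
  field_simp

theorem trajectory_comp_adjoint (a : I → Module.End ℂ H) (R : E →ₗ[ℂ] H) (n : ℕ) (ω : ℕ → I) :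
    trajectory a (R ∘ₗ R.adjoint) n ω = ((‖factorTrajectory a R n ω‖ : ℂ) ^ 2)⁻¹ •
      (factorTrajectory a R n ω ∘ₗ (factorTrajectory a R n ω).adjoint) := by
  rw [trajectory, outcomeWeight_comp_adjoint, factorTrajectory, LinearMap.adjoint_comp]
  rfl

variable [MeasurableSpace I] [Countable I] {a : I → Module.End ℂ H}

theorem IsOutcomeLaw.ae_linearEntropy_trajectory {R : E →ₗ[ℂ] H} {P : Measure (ℕ → I)}
    (hP : IsOutcomeLaw a (R ∘ₗ R.adjoint) P) :
    ∀ᵐ ω ∂P, ∀ n, linearEntropy (trajectory a (R ∘ₗ R.adjoint) n ω)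
      = 1 - purity (factorTrajectory a R n ω) := by
  filter_upwards [hP.ae_factorTrajectory_ne_zero] with ω hω n
  rw [trajectory_comp_adjoint, linearEntropy_inv_smul_comp_adjoint (hω n)]

variable [DiscreteMeasurableSpace I]

theorem pur_of_not_exists_isDark (ha : IsKraus a) (hdark : ¬ ∃ p, IsDark a p) : Pur ha := by
  intro ρ hρ
  obtain ⟨R, rfl⟩ := exists_eq_comp_adjoint hρ.1
  have hP := isOutcomeLaw_outcomeLaw ha hρ
  have hdefect := ae_all_iff.2 fun v : Σ k, Fin k → I => hP.ae_tendsto_defect ha v.2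
  filter_upwards [hdefect, hP.ae_factorTrajectory_ne_zero, hP.ae_linearEntropy_trajectory]
    with ω hdefect hne hentropy
  have hpurity : Tendsto (fun n => purity (factorTrajectory a R n ω)) atTop (𝓝 1) := by
    refine tendsto_purity_one_of_tendsto_defect (fun X hX hzero => ?_) (.of_forall hne) hdefect
    by_contra hX1
    exact hdark (exists_isDark hX hX1 fun k w => hzero ⟨k, w⟩)
  simpa only [hentropy, sub_self] using hpurity.const_sub 1

end Purification

section Projection

variable {𝕜 H : Type*} [RCLike 𝕜] [NormedAddCommGroup H] [InnerProductSpace 𝕜 H]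
  [FiniteDimensional 𝕜 H]

theorem gram_eq_self_of_isSymmetricProjection {p : Module.End 𝕜 H}
    (hp : p.IsSymmetricProjection) : gram p = p := by
  rw [gram, hp.isSymmetric.adjoint_eq]
  exact hp.isIdempotentElem

theorem norm_sq_of_isSymmetricProjection {p : Module.End 𝕜 H} (hp : p.IsSymmetricProjection) :
    ‖p‖ ^ 2 = Module.finrank 𝕜 (LinearMap.range p) := by
  have h : LinearMap.trace 𝕜 H (gram p) = (‖p‖ : 𝕜) ^ 2 := trace_gram p
  rw [gram_eq_self_of_isSymmetricProjection hp,
    (LinearMap.IsIdempotentElem.isProj_range p hp.isIdempotentElem).trace] at h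
  exact_mod_cast h.symm

theorem purity_of_isSymmetricProjection {p : Module.End 𝕜 H} (hp : p.IsSymmetricProjection) :
    purity p = (Module.finrank 𝕜 (LinearMap.range p) : ℝ)⁻¹ := by
  rw [purity, gram_eq_self_of_isSymmetricProjection hp, ← norm_sq_of_isSymmetricProjection hp]
  field_simp

end Projection

section Dark

variable {I E H : Type*} [NormedAddCommGroup H] [InnerProductSpace ℂ H] [FiniteDimensional ℂ H]
  [NormedAddCommGroup E] [InnerProductSpace ℂ E] [FiniteDimensional ℂ E]

theorem isState_comp_adjoint {R : E →ₗ[ℂ] H} (hR : ‖R‖ = 1) : IsState (R ∘ₗ R.adjoint) := by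
  refine ⟨R.isPositive_self_comp_adjoint, ?_⟩
  rw [LinearMap.trace_comp_comm', trace_adjoint_comp_self, hR]
  simp

variable {a : I → Module.End ℂ H} {p : Module.End ℂ H}

theorem IsDark.exists_gram_prodRL_comp (hp : IsDark a p) {n : ℕ} (hn : 1 ≤ n) (w : Fin n → I) :
    ∃ c : ℂ, gram (prodRL a w ∘ₗ p) = c • gram p := by
  obtain ⟨c, -, hc⟩ := hp.2.2 n hn (w ∘ Fin.rev)
  rw [prodLR_comp_rev, mul_assoc, mul_assoc] at hc
  refine ⟨c, ?_⟩
  rw [gram_eq_self_of_isSymmetricProjection hp.1, ← hc, gram, LinearMap.adjoint_comp,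
    hp.1.isSymmetric.adjoint_eq]
  rfl

theorem IsDark.purity_factorTrajectory (hp : IsDark a p) {c : ℂ} {n : ℕ} (hn : 1 ≤ n) {ω : ℕ → I}
    (hne : factorTrajectory a (c • p) n ω ≠ 0) :
    purity (factorTrajectory a (c • p) n ω)
      = (Module.finrank ℂ (LinearMap.range p) : ℝ)⁻¹ := by
  obtain ⟨d, hd⟩ := hp.exists_gram_prodRL_comp hn (firstOutcomes n ω)
  rw [← purity_of_isSymmetricProjection hp.1]
  refine purity_eq_of_gram_eq_smul (c := ((‖c‖ ^ 2 : ℝ) : ℂ) * d) ?_ hne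
  rw [factorTrajectory, LinearMap.comp_smul, gram_smul, hd, smul_smul]
  rfl

theorem IsDark.not_pur [MeasurableSpace I] [DiscreteMeasurableSpace I] [Countable I]
    (hp : IsDark a p) (ha : IsKraus a) : ¬ Pur ha := by
  intro hpur
  let r : ℝ := Module.finrank ℂ (LinearMap.range p)
  have hr : 2 ≤ r := Nat.ofNat_le_cast.2 hp.2.1
  have hnorm : ‖p‖ ≠ 0 := fun h => by
    have := norm_sq_of_isSymmetricProjection hp.1
    rw [h] at this
    linarith
  have hρ := isState_comp_adjoint (R := (‖p‖ : ℂ)⁻¹ • p) (by simp [norm_smul, hnorm])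
  have hP := isOutcomeLaw_outcomeLaw ha hρ
  have := hP.1
  obtain ⟨ω, hlim, hne, hentropy⟩ := ((hpur _ hρ).and
    (hP.ae_factorTrajectory_ne_zero.and hP.ae_linearEntropy_trajectory)).exists
  simp only [hentropy] at hlim
  have hconst : Tendsto (fun n => 1 - purity (factorTrajectory a ((‖p‖ : ℂ)⁻¹ • p) n ω)) atTop
      (𝓝 (1 - r⁻¹)) := by
    refine tendsto_const_nhds.congr' ?_
    filter_upwards [eventually_ge_atTop 1] with n hn
    rw [hp.purity_factorTrajectory hn (hne n)]
  have hr1 : r⁻¹ = 1 := (sub_eq_zero.1 (tendsto_nhds_unique hconst hlim)).symm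
  linarith [inv_eq_one.1 hr1]

end Dark

end QuantumTrajectory

end

theorem corollary4p1 {I H : Type*} [Countable I] [MeasurableSpace I] [DiscreteMeasurableSpace I]
    [NormedAddCommGroup H] [InnerProductSpace ℂ H] [FiniteDimensional ℂ H]
    (a : I → Module.End ℂ H) (ha : QuantumTrajectory.IsKraus a) :
    ¬ QuantumTrajectory.Pur ha ↔ ∃ p : Module.End ℂ H, QuantumTrajectory.IsDark a p := by
  refine ⟨fun hpur => ?_, fun ⟨_, hp⟩ => hp.not_pur ha⟩
  by_contra hdark
  exact hpur (QuantumTrajectory.pur_of_not_exists_isDark ha hdark)
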